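/- Let $m\ge 0$, let $M$ be a smooth manifold of dimension $m$ (without boundary, Hausdorff and second countable), and let $\{U_i\}_{i\in I}$ be an open cover of $M$ with nonempty index set $I$. Then there are $n\ge 0$ and a smooth proper embedding $f\colon M\to\mathbb R^n$ such that for every open ball $B\subset\mathbb R^n$ of radius $1$ (in the Euclidean metric) the preimage $f^{-1}(B)$ is an open subset of some $U_i$. If $M=\mathbb R^m$ or, more generally, if $M$ is diffeomorphic to $\mathbb R^m$, then such an $f$ can be chosen to be a diffeomorphism $f\colon M\to\mathbb R^m$. -/

import Mathlib

open scoped Manifold ContDiff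

/-!
Both parts reduce to the case of a cover of a Euclidean space. There a radial diffeomorphism
`x ↦ h (‖x‖ ^ 2) • x`, with `h` smooth, monotone and growing fast enough to beat the Lebesgue numbers
of the cover on large balls, pulls every unit ball back into a member of the cover
(`exists_diffeomorph_preimage_ball_subset`). If `M` is diffeomorphic to `ℝ^m`, this finishes the
proof. In general, embed `M` properly in some `ℝ^n`, extend the cover of the closed image to a cover
of `ℝ^n`, and compose the embedding with the resulting diffeomorphism.

For the proper embedding, `M` is first covered by finitely many disjoint unions of relatively compact
chart domains. Start from a locally finite, countable bump covering. After a generic rescaling at most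
`m + 1` bumps share a common positive value at any point: a violation by a given finite subfamily
confines the scaling factors to a set of too small a Hausdorff dimension
(`exists_forall_not_common_level`). The sets `topSet u S` on which the bumps in `S` dominate all
others, for `S` with at most `m + 1` elements, therefore cover `M`, and two of them with `S` of equal
cardinality are disjoint. A partition of unity subordinate to this cover yields bumps coloured by
cardinality (`exists_colouredBumpFamily`).

For each colour, the map cutting off `(chart, 1, label)` by the bumps of that colour is smooth, and
the tuple of these maps is injective and proper because the labels are distinct natural numbers. Near
a point where some bump equals `1`, a linear projection of the tuple is a chart, so that the map is
locally a graph over a chart and hence an immersion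
(`Manifold.isImmersionAtOfComplement_of_linear_comp_eq_chart`).
-/

open Set Filter Topology

/-! ### Expanding diffeomorphisms of Euclidean spaces -/

/-- A smooth monotone function dominating a prescribed step function. -/
theorem exists_contDiff_monotone_ge (a : ℕ → ℝ) :
    ∃ h : ℝ → ℝ, ContDiff ℝ ∞ h ∧ Monotone h ∧ (∀ t, 1 ≤ h t) ∧
      ∀ (k : ℕ) (t : ℝ), k ≤ t → a k ≤ h t := by
  set b : ℕ → ℝ → ℝ := fun k t ↦ |a k| * Real.smoothTransition (t - k + 1) with hb
  have hsupp : ∀ k t, b k t ≠ 0 → (k : ℝ) < t + 1 := by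
    intro k t hkt
    by_contra! hle
    exact hkt (by simp [hb, Real.smoothTransition.zero_of_nonpos (by linarith : t - k + 1 ≤ 0)])
  have hfin : ∀ t, (Function.support fun k ↦ b k t).Finite := fun t ↦
    (Set.finite_lt_nat (⌈t + 1⌉₊)).subset fun k hk ↦ Nat.lt_ceil.2 (hsupp k t hk)
  have hnn : ∀ k t, 0 ≤ b k t := fun k t ↦
    mul_nonneg (abs_nonneg _) (Real.smoothTransition.nonneg _)
  have hlf : LocallyFinite fun k ↦ Function.support (b k) := by
    intro t
    refine ⟨Iio (t + 1), Iio_mem_nhds (by linarith), ?_⟩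
    refine (Set.finite_lt_nat (⌈t + 2⌉₊)).subset ?_
    rintro k ⟨s, hs, hst⟩
    have := hsupp k s hs
    exact Nat.lt_ceil.2 (by have := mem_Iio.1 hst; linarith)
  have hbs : ∀ k, ContDiff ℝ ∞ (b k) := fun k ↦
    contDiff_const.mul (Real.smoothTransition.contDiff.comp
      ((contDiff_id.sub contDiff_const).add contDiff_const))
  refine ⟨fun t ↦ 1 + ∑ᶠ k, b k t, ?_, ?_, ?_, ?_⟩
  · exact contDiff_const.add (contMDiff_iff_contDiff.1
      (contMDiff_finsum (fun k ↦ (hbs k).contMDiff) hlf))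
  · intro s t hst
    refine add_le_add_right (finsum_le_finsum' (hfin s) (hfin t) fun k ↦ ?_) 1
    exact mul_le_mul_of_nonneg_left (Real.smoothTransition.monotone (by linarith)) (abs_nonneg _)
  · intro t
    linarith [finsum_nonneg fun k ↦ hnn k t]
  · intro k t hkt
    have h1 : b k t = |a k| := by
      simp [hb, Real.smoothTransition.one_of_one_le (by linarith : 1 ≤ t - k + 1)]
    have h2 : b k t ≤ ∑ᶠ k, b k t := single_le_finsum k (hfin t) fun k ↦ hnn k t
    linarith [le_abs_self (a k)]

section Expanding

variable {E : Type*} [NormedAddCommGroup E]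

theorem norm_le_norm_fderiv_of_expanding [NormedSpace ℝ E] {g : E → E}
    (hg : ∀ x y, ‖x - y‖ ≤ ‖g x - g y‖) {x : E} {g' : E →L[ℝ] E} (h : HasFDerivAt g g' x) (v : E) :
    ‖v‖ ≤ ‖g' v‖ := by
  have hd : HasDerivAt (fun t : ℝ ↦ g (x + t • v)) (g' v) 0 := by
    have h1 : HasDerivAt (fun t : ℝ ↦ x + t • v) v 0 := by
      simpa using ((hasDerivAt_id (0 : ℝ)).smul_const v).const_add x
    have h2 : HasFDerivAt g g' (x + (0 : ℝ) • v) := by simpa using h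
    exact h2.comp_hasDerivAt 0 h1
  refine ge_of_tendsto hd.tendsto_slope_zero.norm ?_
  filter_upwards [self_mem_nhdsWithin] with t ht
  have h3 := hg (x + t • v) x
  have ht' : 0 < |t| := abs_pos.2 ht
  simp only [zero_add, zero_smul, add_zero, norm_smul, norm_inv, Real.norm_eq_abs]
  rw [add_sub_cancel_left, norm_smul, Real.norm_eq_abs] at h3
  rw [inv_mul_eq_div, le_div_iff₀ ht']
  linarith

/-- A smooth expanding self-map of a finite-dimensional space is a diffeomorphism: its range is
closed because the map is antilipschitz, and open because its derivative is invertible. -/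
theorem exists_diffeomorph_of_expanding [NormedSpace ℝ E] [FiniteDimensional ℝ E] {g : E → E}
    (hs : ContDiff ℝ ∞ g) (hg : ∀ x y, ‖x - y‖ ≤ ‖g x - g y‖) :
    ∃ G : Diffeomorph 𝓘(ℝ, E) 𝓘(ℝ, E) E E ∞, ⇑G = g := by
  have hcomplete : CompleteSpace E := FiniteDimensional.complete ℝ E
  have hd : ∀ x, HasFDerivAt g (fderiv ℝ g x) x := fun x ↦
    (hs.differentiable (by simp) x).hasFDerivAt
  have hinj : ∀ x, LinearMap.ker (fderiv ℝ g x : E →ₗ[ℝ] E) = ⊥ := by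
    intro x
    refine LinearMap.ker_eq_bot'.2 fun v hv ↦ ?_
    have h1 := norm_le_norm_fderiv_of_expanding hg (hd x) v
    have h2 : fderiv ℝ g x v = 0 := hv
    rw [h2, norm_zero] at h1
    exact norm_le_zero_iff.1 h1
  set D : E → E ≃L[ℝ] E := fun x ↦
    (LinearEquiv.ofInjectiveEndo (fderiv ℝ g x : E →ₗ[ℝ] E)
      (LinearMap.ker_eq_bot.1 (hinj x))).toContinuousLinearEquiv with hD
  have hDd : ∀ x, HasFDerivAt g (D x : E →L[ℝ] E) x := by
    intro x
    have : (D x : E →L[ℝ] E) = fderiv ℝ g x := by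
      ext v; simp [hD]
    rw [this]; exact hd x
  have hanti : AntilipschitzWith 1 g := AntilipschitzWith.of_le_mul_dist fun x y ↦ by
    simpa [dist_eq_norm] using hg x y
  have hopen : IsOpenMap g := by
    refine isOpenMap_of_hasStrictFDerivAt_equiv (f' := D) fun x ↦ ?_
    exact hs.contDiffAt.hasStrictFDerivAt' (hDd x) (by simp)
  have hclosed : IsClosed (range g) :=
    (isProperMap_iff_tendsto_cocompact.2 ⟨hs.continuous, by
      simpa only [Metric.cobounded_eq_cocompact] using hanti.tendsto_cobounded⟩
      ).isClosedMap.isClosed_range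
  have hsurj : Function.Surjective g := by
    rw [← range_eq_univ]
    exact IsClopen.eq_univ ⟨hclosed, hopen.isOpen_range⟩ (range_nonempty g)
  set e : E ≃ₜ E := (Equiv.ofBijective g ⟨hanti.injective, hsurj⟩).toHomeomorphOfContinuousOpen
    hs.continuous hopen with he
  refine ⟨⟨e.toEquiv, hs.contMDiff, (e.contDiff_symm (f₀' := D) hDd hs).contMDiff⟩, rfl⟩

variable [InnerProductSpace ℝ E]

/-- A radial map `x ↦ h (‖x‖ ^ 2) • x` with increasing factor stretches the distance of two points
at least by the factor of the one closer to the origin. -/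
theorem min_mul_norm_sub_le_norm_radial_sub {h : ℝ → ℝ} (hm : Monotone h) (h1 : ∀ t, 1 ≤ h t)
    (x y : E) :
    min (h (‖x‖ ^ 2)) (h (‖y‖ ^ 2)) * ‖x - y‖ ≤ ‖h (‖x‖ ^ 2) • x - h (‖y‖ ^ 2) • y‖ := by
  wlog hxy : ‖x‖ ≤ ‖y‖ generalizing x y
  · have := this y x (le_of_not_ge hxy)
    rwa [min_comm, norm_sub_rev y x, norm_sub_rev (h (‖y‖ ^ 2) • y)] at this
  have hle : h (‖x‖ ^ 2) ≤ h (‖y‖ ^ 2) := hm (by gcongr)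
  rw [min_eq_left hle, norm_sub_rev x y, norm_sub_rev (h (‖x‖ ^ 2) • x)]
  set p := h (‖x‖ ^ 2)
  set q := h (‖y‖ ^ 2)
  have hp : 1 ≤ p := h1 _
  -- `y - x` makes an acute angle with `y`, so the radial excess only lengthens `p • (y - x)`
  have hin : 0 ≤ inner ℝ (y - x) y := by
    rw [inner_sub_left, real_inner_self_eq_norm_sq]
    nlinarith [real_inner_le_norm x y, norm_nonneg x, norm_nonneg y]
  have hdec : q • y - p • x = p • (y - x) + (q - p) • y := by
    module
  refine le_of_sq_le_sq ?_ (norm_nonneg _)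
  rw [hdec, norm_add_sq_real, real_inner_smul_left, real_inner_smul_right, norm_smul p,
    Real.norm_of_nonneg (by linarith)]
  have : 0 ≤ p * ((q - p) * inner ℝ (y - x) y) :=
    mul_nonneg (by linarith) (mul_nonneg (by linarith) hin)
  nlinarith [sq_nonneg ‖(q - p) • y‖]

/-- For an open cover of a Euclidean space, some radial diffeomorphism expands so quickly at
infinity that the preimage of every unit ball lies in a member of the cover. -/
theorem exists_diffeomorph_preimage_ball_subset [FiniteDimensional ℝ E] {ι : Type*}
    (U : ι → Set E) (hU : ∀ i, IsOpen (U i)) (hcov : ⋃ i, U i = univ) :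
    ∃ G : Diffeomorph 𝓘(ℝ, E) 𝓘(ℝ, E) E E ∞, ∀ c, ∃ i, G ⁻¹' Metric.ball c 1 ⊆ U i := by
  have hproper : ProperSpace E := FiniteDimensional.proper ℝ E
  have hleb : ∀ K : ℕ, ∃ δ > 0, ∀ x ∈ Metric.closedBall (0 : E) K, ∃ i, Metric.ball x δ ⊆ U i :=
    fun K ↦ lebesgue_number_lemma_of_metric (isCompact_closedBall _ _) hU (by simp [hcov])
  choose δ hδ hball using hleb
  obtain ⟨h, hs, hm, h1, ha⟩ :=
    exists_contDiff_monotone_ge fun j ↦ ∑ K ∈ Finset.range (j + 4), (δ K)⁻¹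
  -- If `K - 1 < ‖x‖ ≤ K`, a point at distance less than `1` from `x` has squared norm greater than
  -- `K - 3`; the sum up to `j + 3` makes the factor there at least `(δ K)⁻¹`.
  set g : E → E := fun x ↦ h (‖x‖ ^ 2) • x with hg
  have hmin : ∀ x y, min (h (‖x‖ ^ 2)) (h (‖y‖ ^ 2)) * ‖x - y‖ ≤ ‖g x - g y‖ :=
    min_mul_norm_sub_le_norm_radial_sub hm h1
  have hexp : ∀ x y, ‖x - y‖ ≤ ‖g x - g y‖ := fun x y ↦
    le_trans (le_mul_of_one_le_left (norm_nonneg _) (le_min (h1 _) (h1 _))) (hmin x y)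
  have hgs : ContDiff ℝ ∞ g := (hs.comp (contDiff_norm_sq ℝ)).smul contDiff_id
  obtain ⟨G, hG⟩ := exists_diffeomorph_of_expanding hgs hexp
  refine ⟨G, fun c ↦ ?_⟩
  obtain ⟨x, rfl⟩ := G.surjective c
  set K := ⌈‖x‖⌉₊
  obtain ⟨i, hi⟩ := hball K x (by simpa using Nat.le_ceil _)
  refine ⟨i, Subset.trans (fun y hy ↦ ?_) hi⟩
  rw [mem_preimage, mem_ball_iff_norm, norm_sub_rev, hG] at hy
  change ‖G x - g y‖ < 1 at hy
  rw [hG] at hy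
  rw [mem_ball_iff_norm, norm_sub_rev]
  have hxy : ‖x - y‖ < 1 := (hexp x y).trans_lt hy
  have hK : (K : ℝ) < ‖x‖ + 1 := Nat.ceil_lt_add_one (norm_nonneg x)
  have hxn : ‖x‖ < ‖y‖ + 1 := by linarith [norm_sub_norm_le x y]
  have key : ∀ z : E, ‖x‖ < ‖z‖ + 1 → (δ K)⁻¹ ≤ h (‖z‖ ^ 2) := by
    intro z hz
    refine le_trans ?_ (ha (K - 3) (‖z‖ ^ 2) ?_)
    · exact Finset.single_le_sum (f := fun K ↦ (δ K)⁻¹)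
        (fun K _ ↦ (inv_pos.2 (hδ K)).le) (Finset.mem_range.2 (by omega))
    · rcases le_total K 3 with h3 | h3
      · rw [Nat.sub_eq_zero_of_le h3]; simp only [Nat.cast_zero]; positivity
      · rw [Nat.cast_sub h3]; push_cast
        nlinarith [sq_nonneg (‖z‖ - 1)]
  have hle : (δ K)⁻¹ * ‖x - y‖ < 1 :=
    lt_of_le_of_lt ((mul_le_mul_of_nonneg_right
      (le_min (key x (by linarith)) (key y hxn)) (norm_nonneg _)).trans (hmin x y)) hy
  rwa [inv_mul_lt_one₀ (hδ K)] at hle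

end Expanding

/-! ### Immersions in graph form -/

theorem Manifold.IsImmersionAtOfComplement.diffeomorph_comp
    {E F E' H H' M N N' : Type*}
    [NormedAddCommGroup E] [NormedSpace ℝ E] [NormedAddCommGroup F] [NormedSpace ℝ F]
    [NormedAddCommGroup E'] [NormedSpace ℝ E']
    [TopologicalSpace H] [TopologicalSpace H']
    {I : ModelWithCorners ℝ E H} {J : ModelWithCorners ℝ E' H'}
    [TopologicalSpace M] [ChartedSpace H M] [TopologicalSpace N] [ChartedSpace H' N]
    [TopologicalSpace N'] [ChartedSpace H' N'] {n : ℕ∞ω} [IsManifold J n N] [IsManifold J n N']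
    {f : M → N} {x : M} (hf : IsImmersionAtOfComplement F I J n f x) (G : Diffeomorph J J N N' n) :
    IsImmersionAtOfComplement F I J n (G ∘ f) x := by
  have hψ := hf.codChart_mem_maximalAtlas
  refine .mk_of_charts hf.equiv hf.domChart
    (G.symm.toHomeomorph.toOpenPartialHomeomorph.trans hf.codChart)
    hf.mem_domChart_source ?_ hf.domChart_mem_maximalAtlas ?_ ?_ ?_
  · simpa using hf.mem_codChart_source
  · refine OpenPartialHomeomorph.mem_maximalAtlas_of_contMDiffOn (I := J) (n := n) _ ?_ ?_
    · refine (contMDiffOn_of_mem_maximalAtlas hψ).comp G.symm.contMDiff.contMDiffOn ?_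
      intro y hy
      simpa using hy
    · refine G.contMDiff.comp_contMDiffOn ((contMDiffOn_symm_of_mem_maximalAtlas hψ).mono ?_)
      intro y hy
      simpa using hy
  · intro y hy
    simpa using hf.source_subset_preimage_source hy
  · intro u hu
    simpa using hf.writtenInCharts hu

/-- A map whose composition with a split linear surjection `L` is a chart `φ` is an immersion: it is
the graph of a smooth map over `φ`, and subtracting that map from the target straightens it. -/
theorem Manifold.isImmersionAtOfComplement_of_linear_comp_eq_chart
    {E E' F M : Type*} [NormedAddCommGroup E] [NormedSpace ℝ E]
    [NormedAddCommGroup E'] [NormedSpace ℝ E'] [NormedAddCommGroup F] [NormedSpace ℝ F]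
    [TopologicalSpace M] [ChartedSpace E M] [IsManifold 𝓘(ℝ, E) ∞ M] {f : M → E'} {x : M}
    (hf : ContMDiff 𝓘(ℝ, E) 𝓘(ℝ, E') ∞ f) (φ : OpenPartialHomeomorph M E) (hx : x ∈ φ.source)
    (hφ : φ ∈ IsManifold.maximalAtlas 𝓘(ℝ, E) ∞ M) (L : E' →L[ℝ] E) (s : E →L[ℝ] E')
    (hLs : Function.RightInverse s L) (hL : ∀ y ∈ φ.source, L (f y) = φ y)
    (e : F ≃L[ℝ] L.ker) :
    IsImmersionAtOfComplement F 𝓘(ℝ, E) 𝓘(ℝ, E') ∞ f x := by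
  set G : E → E' := fun u ↦ f (φ.symm u) - s u with hG
  have hGL : ∀ u ∈ φ.target, L (G u) = 0 := by
    intro u hu
    have := hL (φ.symm u) (φ.map_target hu)
    simp [hG, this, φ.right_inv hu, hLs u]
  have hGs : ContDiffOn ℝ ∞ G φ.target := by
    refine ContDiffOn.sub ?_ s.contDiff.contDiffOn
    exact contMDiffOn_iff_contDiffOn.1 (hf.comp_contMDiffOn
      (contMDiffOn_symm_of_mem_maximalAtlas hφ))
  have hGLs : ContDiffOn ℝ ∞ (fun y ↦ G (L y)) (L ⁻¹' φ.target) :=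
    hGs.comp L.contDiff.contDiffOn fun y hy ↦ hy
  set ψ : OpenPartialHomeomorph E' E' :=
    { toFun := fun y ↦ y - G (L y)
      invFun := fun y ↦ y + G (L y)
      source := L ⁻¹' φ.target
      target := L ⁻¹' φ.target
      map_source' := fun y hy ↦ by simpa [hGL _ hy] using hy
      map_target' := fun y hy ↦ by simpa [hGL _ hy] using hy
      left_inv' := fun y hy ↦ by simp [hGL _ hy]
      right_inv' := fun y hy ↦ by simp [hGL _ hy]
      open_source := φ.open_target.preimage L.continuous
      open_target := φ.open_target.preimage L.continuous
      continuousOn_toFun := continuousOn_id.sub hGLs.continuousOn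
      continuousOn_invFun := continuousOn_id.add hGLs.continuousOn } with hψ
  refine (IsImmersionAtOfComplement.congr_F e).2 ?_
  refine .mk_of_continuousAt hf.continuous.continuousAt
    (ContinuousLinearEquiv.equivOfRightInverse L s hLs).symm φ ψ hx ?_ hφ ?_ ?_
  · change L (f x) ∈ φ.target
    rw [hL x hx]
    exact φ.map_source hx
  · refine OpenPartialHomeomorph.mem_maximalAtlas_of_contMDiffOn (I := 𝓘(ℝ, E')) (n := ∞) _ ?_ ?_
    · exact contMDiffOn_iff_contDiffOn.2 (contDiffOn_id.sub hGLs)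
    · exact contMDiffOn_iff_contDiffOn.2 (contDiffOn_id.add hGLs)
  · intro u hu
    have hu' : u ∈ φ.target := by simpa using hu
    have h1 : L (f (φ.symm u)) = u := by
      rw [hL _ (φ.map_target hu'), φ.right_inv hu']
    simp [hψ, h1, hG]

/-! ### Generic levels of smooth functions -/

section GenericLevels

variable {E : Type*} [NormedAddCommGroup E] [NormedSpace ℝ E] [FiniteDimensional ℝ E]
  {M : Type*} [TopologicalSpace M] [ChartedSpace E M] [IsManifold 𝓘(ℝ, E) ∞ M]

/-- Sweeping the image of an `m`-manifold along a fixed direction yields a set of Hausdorff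
dimension at most `m + 1`. -/
theorem dimH_image_add_smul_le [SigmaCompactSpace M] {F : Type*} [NormedAddCommGroup F]
    [NormedSpace ℝ F] {W : Set M} (hW : IsOpen W) {g : M → F}
    (hg : ContMDiffOn 𝓘(ℝ, E) 𝓘(ℝ, F) ∞ g W) (w : F) :
    dimH ((fun p : M × ℝ ↦ g p.1 + p.2 • w) '' (W ×ˢ univ)) ≤ (Module.finrank ℝ E + 1 : ℕ) := by
  obtain ⟨C, hC, hcov⟩ := countable_cover_nhds_of_sigmaCompact
    fun x : M ↦ chart_source_mem_nhds E x
  have hCc : Countable C := hC.to_subtype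
  let D : M → Set E := fun c ↦ (chartAt E c).target ∩ (chartAt E c).symm ⁻¹' W
  let Φ : M → E × ℝ → F := fun c q ↦ g ((chartAt E c).symm q.1) + q.2 • w
  have hD : ∀ c, IsOpen (D c) := fun c ↦ (chartAt E c).isOpen_inter_preimage_symm hW
  have hsmooth : ∀ c, ContDiffOn ℝ ∞ (Φ c) (D c ×ˢ univ) := by
    intro c
    have h1 : ContDiffOn ℝ ∞ (fun u ↦ g ((chartAt E c).symm u)) (D c) := by
      refine contMDiffOn_iff_contDiffOn.1 (hg.comp
        ((contMDiffOn_chart_symm (x := c)).mono inter_subset_left) fun u hu ↦ hu.2)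
    exact (h1.comp contDiffOn_fst fun q hq ↦ hq.1).add
      (contDiffOn_snd.smul contDiffOn_const)
  have hsub : (fun p : M × ℝ ↦ g p.1 + p.2 • w) '' (W ×ˢ univ) ⊆
      ⋃ c : C, Φ c '' (D c ×ˢ univ) := by
    rintro _ ⟨⟨x, r⟩, ⟨hx, -⟩, rfl⟩
    obtain ⟨c, hc, hxc⟩ := mem_iUnion₂.1
      (hcov.symm ▸ mem_univ x : x ∈ ⋃ c ∈ C, (chartAt E c).source)
    refine mem_iUnion.2 ⟨⟨c, hc⟩, (chartAt E c x, r),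
      ⟨⟨(chartAt E c).map_source hxc, ?_⟩, mem_univ _⟩, ?_⟩
    · simpa [(chartAt E c).left_inv hxc] using hx
    · simp [Φ, (chartAt E c).left_inv hxc]
  refine (dimH_mono hsub).trans ?_
  rw [dimH_iUnion]
  refine iSup_le fun c ↦ (dimH_image_le_of_locally_lipschitzOn fun q hq ↦ ?_).trans
    ((dimH_mono (subset_univ _)).trans ?_)
  · have hn : D c ×ˢ (univ : Set ℝ) ∈ 𝓝 q := ((hD c).prod isOpen_univ).mem_nhds hq
    obtain ⟨K, t, ht, hK⟩ := (((hsmooth c).contDiffAt hn).of_le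
      (by simp : (1 : ℕ∞ω) ≤ ∞)).exists_lipschitzOnWith
    exact ⟨K, t, mem_nhdsWithin_of_mem_nhds ht, hK⟩
  · rw [Real.dimH_univ_eq_finrank]
    simp

/-- **Generic levels.** After rescaling countably many smooth functions by suitable factors
`exp tᵢ`, no `m + 2` of them take a common positive value at a point of an `m`-manifold. The scaling vectors
excluded by one finite subfamily form a cylinder over a `σ`-compact set of dimension at most
`m + 1`, so Baire's theorem applies. -/
theorem exists_forall_not_common_level [T2Space M] [SecondCountableTopology M] {ι : Type*}
    [Countable ι] {v : ι → M → ℝ} (hv : ∀ i, ContMDiff 𝓘(ℝ, E) 𝓘(ℝ) ∞ (v i)) :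
    ∃ t : ι → ℝ, ∀ S : Finset ι, Module.finrank ℝ E + 1 < S.card → ∀ x, (∀ i ∈ S, 0 < v i x) →
      ∀ r, ¬ ∀ i ∈ S, Real.exp (t i) * v i x = r := by
  classical
  have hlc : LocallyCompactSpace M := ChartedSpace.locallyCompactSpace E M
  let W : Finset ι → Set M := fun S ↦ {x | ∀ i ∈ S, 0 < v i x}
  have hW : ∀ S, IsOpen (W S) := by
    intro S
    have : W S = ⋂ i ∈ S, {x | 0 < v i x} := by ext; simp [W]
    rw [this]
    exact isOpen_biInter_finset fun i _ ↦ isOpen_lt continuous_const (hv i).continuous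
  let g : (S : Finset ι) → M → (S → ℝ) := fun S x i ↦ -Real.log (v i x)
  have hg : ∀ S : Finset ι, ContMDiffOn 𝓘(ℝ, E) 𝓘(ℝ, S → ℝ) ∞ (g S) (W S) := by
    intro S
    refine contMDiffOn_pi_space.2 fun i x hx ↦ ?_
    have h0 : v i x ≠ 0 := (hx i i.2).ne'
    exact (((Real.contDiffAt_log.2 h0).neg).contMDiffAt.comp x (hv i x)).contMDiffWithinAt
  -- `v i x * exp (t i) = exp s` for all `i ∈ S` says that `t` restricted to `S` is `Ψ S (x, s)`.
  let Ψ : (S : Finset ι) → M × ℝ → (S → ℝ) := fun S p ↦ g S p.1 + p.2 • (1 : S → ℝ)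
  have hσ : ∀ S, IsSigmaCompact (Ψ S '' (W S ×ˢ univ)) := by
    intro S
    have hWl : LocallyCompactSpace (W S) := (hW S).locallyCompactSpace
    have hc : Continuous fun p : W S × ℝ ↦ Ψ S (p.1, p.2) := by
      have h1 : Continuous fun x : W S ↦ g S x := (hg S).continuousOn.domRestrict
      exact (h1.comp continuous_fst).add (continuous_snd.smul continuous_const)
    have := isSigmaCompact_range hc
    convert this
    ext y
    constructor
    · rintro ⟨⟨x, r⟩, ⟨hx, -⟩, rfl⟩
      exact ⟨(⟨x, hx⟩, r), rfl⟩
    · rintro ⟨⟨x, r⟩, rfl⟩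
      exact ⟨(x, r), ⟨x.2, mem_univ _⟩, rfl⟩
  choose K hKc hKU using hσ
  let T := {S : Finset ι // Module.finrank ℝ E + 1 < S.card}
  have hdense : Dense (⋂ p : T × ℕ, (fun t : ι → ℝ ↦ fun i : p.1.1 ↦ t i) ⁻¹' (K p.1 p.2)ᶜ) := by
    refine dense_iInter_of_isOpen (fun p ↦ ?_) fun p ↦ ?_
    · exact (hKc _ _).isClosed.isOpen_compl.preimage (by fun_prop)
    · refine Dense.preimage (Dense.mono (compl_subset_compl.2 ((subset_iUnion _ p.2).trans
        (hKU p.1).subset)) ?_) (isOpenMap_fst.comp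
        (Homeomorph.piEquivPiSubtypeProd (· ∈ p.1.1) fun _ : ι ↦ ℝ).isOpenMap)
      refine dense_compl_of_dimH_lt_finrank ((dimH_image_add_smul_le (hW _) (hg _) 1).trans_lt ?_)
      rw [Module.finrank_fintype_fun_eq_card, Fintype.card_coe]
      exact_mod_cast p.1.2
  obtain ⟨t, ht⟩ := hdense.nonempty
  refine ⟨t, fun S hS x hx r hr ↦ ?_⟩
  have hmem : (fun i : S ↦ t i) ∈ Ψ S '' (W S ×ˢ univ) := by
    refine ⟨(x, Real.log r), ⟨hx, mem_univ _⟩, ?_⟩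
    funext i
    have h1 := hr i i.2
    have h2 := hx i i.2
    simp only [Ψ, g, Pi.add_apply, Pi.smul_apply, Pi.one_apply, smul_eq_mul, mul_one]
    rw [← h1, Real.log_mul (Real.exp_pos _).ne' h2.ne', Real.log_exp]
    ring
  rw [← hKU S] at hmem
  obtain ⟨n, hn⟩ := mem_iUnion.1 hmem
  exact mem_iInter.1 ht (⟨S, hS⟩, n) hn

end GenericLevels

/-! ### Coloured bump families -/

/-- A locally finite family of compactly supported bump functions on a manifold modelled on `E`,
coloured by `Fin N`, such that the bump `j` lives in the chart at `center j`, bumps of the same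
colour have disjoint supports, and near each point some bump is identically `1`. -/
structure ColouredBumpFamily (E : Type*) [NormedAddCommGroup E] [NormedSpace ℝ E]
    (M : Type*) [TopologicalSpace M] [ChartedSpace E M] (J : Type*) (N : ℕ) where
  /-- The colour of a bump. -/
  colour : J → Fin N
  /-- The point whose preferred chart contains the support of a bump. -/
  center : J → M
  /-- The bump functions. -/
  bump : J → M → ℝ
  contMDiff_bump : ∀ j, ContMDiff 𝓘(ℝ, E) 𝓘(ℝ) ∞ (bump j)
  tsupport_subset : ∀ j, tsupport (bump j) ⊆ (chartAt E (center j)).source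
  hasCompactSupport : ∀ j, HasCompactSupport (bump j)
  locallyFinite : LocallyFinite fun j ↦ Function.support (bump j)
  eq_of_colour_eq : ∀ {j k x}, colour j = colour k → bump j x ≠ 0 → bump k x ≠ 0 → j = k
  exists_eventuallyEq_one : ∀ x, ∃ j, bump j =ᶠ[𝓝 x] 1

/-- The points at which `u` is positive on `S` and larger on `S` than off `S`. For a partition
of unity `u`, this is the preimage, under the map to the nerve, of the open star of the barycentre of the simplex `S` in the barycentric
subdivision. -/
def topSet {ι M : Type*} (u : ι → M → ℝ) (S : Finset ι) : Set M :=
  {x | ∀ i ∈ S, 0 < u i x ∧ ∀ j ∉ S, u j x < u i x}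

theorem isOpen_topSet {ι M : Type*} [TopologicalSpace M] {u : ι → M → ℝ}
    (hu : ∀ i, Continuous (u i)) (hlf : LocallyFinite fun i ↦ Function.support (u i))
    (S : Finset ι) : IsOpen (topSet u S) := by
  refine isOpen_iff_mem_nhds.2 fun x hx ↦ ?_
  obtain ⟨n, hn, hfin⟩ := hlf x
  have h1 : ∀ᶠ y in 𝓝 x, ∀ i ∈ S, 0 < u i y :=
    (Finset.eventually_all S).2 fun i hi ↦
      continuousAt_const.eventually_lt (hu i).continuousAt (hx i hi).1
  have h2 : ∀ᶠ y in 𝓝 x, ∀ i ∈ S,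
      ∀ j ∈ {j | (Function.support (u j) ∩ n).Nonempty}, j ∉ S → u j y < u i y := by
    refine (Finset.eventually_all S).2 fun i hi ↦ hfin.eventually_all.2 fun j _ ↦ ?_
    by_cases hj : j ∈ S
    · exact Eventually.of_forall fun y h ↦ absurd hj h
    · exact ((hu j).continuousAt.eventually_lt (hu i).continuousAt ((hx i hi).2 j hj)).mono
        fun y hy _ ↦ hy
  filter_upwards [h1, h2, hn] with y hy1 hy2 hyn i hi
  refine ⟨hy1 i hi, fun j hj ↦ ?_⟩
  by_cases hjy : u j y = 0
  · exact hjy ▸ hy1 i hi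
  · exact hy2 i hi j ⟨y, hjy, hyn⟩ hj

/-- Top sets of distinct index sets of equal cardinality are disjoint: each index set contains an
element that would have to dominate one of the other. -/
theorem eq_of_mem_topSet {ι M : Type*} {u : ι → M → ℝ} {S T : Finset ι} (h : S.card = T.card)
    {x : M} (hS : x ∈ topSet u S) (hT : x ∈ topSet u T) : S = T := by
  by_contra hne
  have h1 : ¬ S ⊆ T := fun hs ↦ hne (Finset.eq_of_subset_of_card_le hs h.ge)
  have h2 : ¬ T ⊆ S := fun hs ↦ hne (Finset.eq_of_subset_of_card_le hs h.le).symm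
  obtain ⟨i, hiS, hiT⟩ := Finset.not_subset.1 h1
  obtain ⟨j, hjT, hjS⟩ := Finset.not_subset.1 h2
  exact lt_asymm ((hS i hiS).2 j hjS) ((hT j hjT).2 i hiT)

/-- A point lies in the top set of the indices where the family is maximal. -/
theorem exists_mem_topSet {ι M : Type*} {u : ι → M → ℝ} {x : M} (hnn : ∀ i, 0 ≤ u i x)
    (hfin : {i | u i x ≠ 0}.Finite) (hne : ∃ i, u i x ≠ 0) :
    ∃ S : Finset ι, S.Nonempty ∧ x ∈ topSet u S ∧ ∃ r, ∀ i ∈ S, u i x = r := by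
  classical
  obtain ⟨i₀, hi₀⟩ := hne
  obtain ⟨k, hk, hmax⟩ := hfin.toFinset.exists_max_image (fun i ↦ u i x) ⟨i₀, by simpa using hi₀⟩
  have hk0 : 0 < u k x := lt_of_le_of_ne (hnn k) (Ne.symm (by simpa using hk))
  have hle : ∀ i, u i x ≤ u k x := by
    intro i
    by_cases hi : u i x = 0
    · exact hi ▸ hk0.le
    · exact hmax i (by simpa using hi)
  have hmem : ∀ i, i ∈ hfin.toFinset.filter (fun i ↦ u i x = u k x) ↔ u i x = u k x := by
    intro i
    simp only [Finset.mem_filter, Finite.mem_toFinset, mem_ofPred_eq, and_iff_right_iff_imp]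
    exact fun h ↦ h ▸ hk0.ne'
  refine ⟨hfin.toFinset.filter (fun i ↦ u i x = u k x), ⟨k, (hmem k).2 rfl⟩, fun i hi ↦ ?_,
    u k x, fun i hi ↦ (hmem i).1 hi⟩
  rw [hmem] at hi
  refine ⟨hi ▸ hk0, fun j hj ↦ ?_⟩
  rw [hi]
  exact lt_of_le_of_ne (hle j) fun h ↦ hj ((hmem j).2 h)

/-- If the members of a partition of unity that are nonzero at `x` have distinct colours among `N`,
one of them is at least `1 / N` there. -/
theorem SmoothPartitionOfUnity.exists_one_le_mul {E M J : Type*} [NormedAddCommGroup E]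
    [NormedSpace ℝ E] [TopologicalSpace M] [ChartedSpace E M]
    (ρ : SmoothPartitionOfUnity J 𝓘(ℝ, E) M) {N : ℕ} (col : J → Fin N) (x : M)
    (hcol : ∀ j k, col j = col k → ρ j x ≠ 0 → ρ k x ≠ 0 → j = k) : ∃ j, 1 ≤ N * ρ j x := by
  by_contra! hlt
  have hsum : ∑ j ∈ ρ.finsupport x, ρ j x = 1 := ρ.sum_finsupport x (mem_univ x)
  have hne : (ρ.finsupport x).Nonempty := by
    by_contra h
    rw [Finset.not_nonempty_iff_eq_empty.1 h] at hsum
    simp at hsum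
  have hcard : (ρ.finsupport x).card ≤ N := by
    have h1 : (ρ.finsupport x).card ≤ (Finset.univ : Finset (Fin N)).card := by
      refine Finset.card_le_card_of_injOn col (fun _ _ ↦ Finset.mem_coe.2 (Finset.mem_univ _)) ?_
      intro j hj k hk hjk
      exact hcol j k hjk (by simpa using hj) (by simpa using hk)
    simpa using h1
  have h2 : ∑ j ∈ ρ.finsupport x, (N * ρ j x) < ∑ j ∈ ρ.finsupport x, (1 : ℝ) :=
    Finset.sum_lt_sum_of_nonempty hne fun j _ ↦ hlt j
  rw [← Finset.mul_sum, hsum, Finset.sum_const, nsmul_eq_mul, mul_one, mul_one] at h2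
  exact absurd hcard (by exact_mod_cast h2.not_ge)

universe uM in
/-- Every second countable Hausdorff `m`-manifold has a coloured bump family with `m + 2` colours.
Its members are indexed by sets `S` of at most `m + 1` bumps of a generically rescaled bump
covering, the one belonging to `S` being supported where the bumps in `S` dominate all others;
the colour of `S` is its cardinality, so that colour `0` does not occur. -/
theorem exists_colouredBumpFamily {E : Type*} [NormedAddCommGroup E] [NormedSpace ℝ E]
    [FiniteDimensional ℝ E] {M : Type uM} [TopologicalSpace M] [ChartedSpace E M]
    [IsManifold 𝓘(ℝ, E) ∞ M] [T2Space M] [SecondCountableTopology M] :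
    ∃ J : Type uM, Countable J ∧
      Nonempty (ColouredBumpFamily E M J (Module.finrank ℝ E + 2)) := by
  have hlc : LocallyCompactSpace M := ChartedSpace.locallyCompactSpace E M
  obtain ⟨ι, fs, -⟩ := SmoothBumpCovering.exists_isSubordinate 𝓘(ℝ, E) (isClosed_univ (X := M))
    (U := fun _ ↦ univ) fun x _ ↦ univ_mem
  have hι : Countable ι := countable_univ_iff.1
    (fs.locallyFinite.countable_univ fun i ↦ (fs i).nonempty_support)
  obtain ⟨t, ht⟩ := exists_forall_not_common_level (v := fun i ↦ fs i) fun i ↦ (fs i).contMDiff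
  set u : ι → M → ℝ := fun i x ↦ Real.exp (t i) * fs i x with hu
  have hsupp : ∀ i x, u i x ≠ 0 ↔ fs i x ≠ 0 := fun i x ↦ by simp [hu]
  have hsupp' : ∀ i, Function.support (u i) = Function.support (fs i) := fun i ↦ by
    ext x; exact hsupp i x
  have hlf : LocallyFinite fun i ↦ Function.support (u i) := by
    simpa only [hsupp'] using fs.locallyFinite
  let J := {S : Finset ι // S.Nonempty ∧ S.card ≤ Module.finrank ℝ E + 1}
  have hopen : ∀ S : J, IsOpen (topSet u S) := fun S ↦
    isOpen_topSet (fun i ↦ continuous_const.mul (fs i).continuous) hlf S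
  have hcov : (univ : Set M) ⊆ ⋃ S : J, topSet u S := by
    intro x _
    obtain ⟨S, hS, hx, r, hr⟩ := exists_mem_topSet (u := u) (x := x)
      (fun i ↦ mul_nonneg (Real.exp_pos _).le (fs i).nonneg) (hlf.point_finite x)
      ⟨fs.ind x (mem_univ x), by simp [hsupp, fs.apply_ind]⟩
    refine mem_iUnion.2 ⟨⟨S, hS, ?_⟩, hx⟩
    by_contra! hcard
    exact ht S hcard x (fun i hi ↦ pos_of_mul_pos_right (hx i hi).1 (Real.exp_pos _).le) r hr
  obtain ⟨ρ, hρ⟩ := SmoothPartitionOfUnity.exists_isSubordinate 𝓘(ℝ, E) isClosed_univ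
    (fun S : J ↦ topSet u S) hopen hcov
  let col : J → Fin (Module.finrank ℝ E + 2) := fun S ↦ ⟨S.1.card, by have := S.2.2; omega⟩
  have hcol : ∀ S T x, col S = col T → ρ S x ≠ 0 → ρ T x ≠ 0 → S = T := by
    intro S T x hST hS hT
    exact Subtype.ext (eq_of_mem_topSet (Fin.mk.inj_iff.1 hST) (hρ S (subset_tsupport _ hS))
      (hρ T (subset_tsupport _ hT)))
  let N : ℝ := (Module.finrank ℝ E + 2 : ℕ)
  have hN : 0 < N := by positivity
  -- Some `ρ S x` is at least `1 / N`, so `(N + 1) * ρ S` exceeds `1` on a neighbourhood of `x`.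
  let β : J → M → ℝ := fun S x ↦ Real.smoothTransition ((N + 1) * ρ S x)
  have hβρ : ∀ S, Function.support (β S) ⊆ Function.support (ρ S) := by
    intro S x hx h0
    exact hx (by simp [β, h0])
  have htsupp : ∀ S : J, tsupport (β S) ⊆ tsupport (fs S.2.1.choose) := by
    intro S
    refine closure_mono ((hβρ S).trans fun x hx ↦ ?_)
    exact (hsupp _ _).1 ((hρ S (subset_tsupport _ hx)) _ S.2.1.choose_spec).1.ne'
  refine ⟨J, inferInstance, ⟨{
    colour := col
    center := fun S ↦ fs.c S.2.1.choose
    bump := β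
    contMDiff_bump := fun S ↦ ?_
    tsupport_subset := fun S ↦ (htsupp S).trans (fs _).tsupport_subset_chartAt_source
    hasCompactSupport := fun S ↦
      (fs _).hasCompactSupport.of_isClosed_subset (isClosed_tsupport _) (htsupp S)
    locallyFinite := ρ.locallyFinite.subset hβρ
    eq_of_colour_eq := fun {S T x} h hS hT ↦ hcol S T x h (hβρ S hS) (hβρ T hT)
    exists_eventuallyEq_one := fun x ↦ ?_ }⟩⟩
  · exact Real.smoothTransition.contDiff.contMDiff.comp (contMDiff_const.mul (ρ S).contMDiff)
  · obtain ⟨S, hS⟩ := ρ.exists_one_le_mul col x fun j k ↦ hcol j k x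
    refine ⟨S, ?_⟩
    have hpos : 0 < ρ S x := pos_of_mul_pos_right (zero_lt_one.trans_le hS) hN.le
    have h1 : ∀ᶠ y in 𝓝 x, 1 < (N + 1) * ρ S y :=
      continuousAt_const.eventually_lt
        (continuous_const.mul (ρ S).contMDiff.continuous).continuousAt
        (by change 1 < (N + 1) * ρ S x; change 1 ≤ N * ρ S x at hS; linarith)
    filter_upwards [h1] with y hy
    exact Real.smoothTransition.one_of_one_le hy.le

/-! ### Proper embeddings -/

namespace ColouredBumpFamily

variable {E : Type*} [NormedAddCommGroup E] [NormedSpace ℝ E] {M : Type*} [TopologicalSpace M]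
  [ChartedSpace E M] {J : Type*} {N : ℕ}

/-- The component of colour `k` of the embedding given by a coloured bump family: the chart of the
bump of colour `k` that is alive at `x`, together with `1` and the label `ν j` of that bump, all cut
off by the bump. -/
noncomputable def block (B : ColouredBumpFamily E M J N) (ν : J → ℕ) (k : Fin N) (x : M) :
    E × ℝ × ℝ :=
  ∑ᶠ j, if B.colour j = k then B.bump j x • (chartAt E (B.center j) x, (1 : ℝ), (ν j : ℝ)) else 0

theorem block_eq (B : ColouredBumpFamily E M J N) (ν : J → ℕ) {j : J} {x : M}
    (hj : B.bump j x ≠ 0) : B.block ν (B.colour j) x =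
      B.bump j x • (chartAt E (B.center j) x, (1 : ℝ), (ν j : ℝ)) := by
  rw [block, finsum_eq_single _ j, if_pos rfl]
  intro k hk
  split_ifs with hc
  · have h0 : B.bump k x = 0 := by
      by_contra h
      exact hk (B.eq_of_colour_eq hc h hj)
    rw [h0, zero_smul]
  · rfl

theorem exists_of_block_ne_zero (B : ColouredBumpFamily E M J N) {ν : J → ℕ} {k : Fin N} {x : M}
    (h : B.block ν k x ≠ 0) : ∃ j, B.colour j = k ∧ B.bump j x ≠ 0 := by
  by_contra! h0
  refine h (finsum_eq_zero_of_forall_eq_zero fun j ↦ ?_)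
  split_ifs with hc
  · rw [h0 j hc, zero_smul]
  · rfl

theorem exists_eq_one (B : ColouredBumpFamily E M J N) (x : M) : ∃ j, B.bump j x = 1 :=
  (B.exists_eventuallyEq_one x).imp fun _ h ↦ h.eq_of_nhds

theorem block_eq_of_eq_one (B : ColouredBumpFamily E M J N) (ν : J → ℕ) {j : J} {x : M}
    (hj : B.bump j x = 1) :
    B.block ν (B.colour j) x = (chartAt E (B.center j) x, (1 : ℝ), (ν j : ℝ)) := by
  rw [B.block_eq ν (by rw [hj]; exact one_ne_zero), hj, one_smul]

theorem mem_source (B : ColouredBumpFamily E M J N) {j : J} {x : M} (hj : B.bump j x ≠ 0) :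
    x ∈ (chartAt E (B.center j)).source :=
  B.tsupport_subset j (subset_tsupport _ hj)

theorem contMDiff_block [IsManifold 𝓘(ℝ, E) ∞ M] (B : ColouredBumpFamily E M J N) (ν : J → ℕ)
    (k : Fin N) : ContMDiff 𝓘(ℝ, E) 𝓘(ℝ, E × ℝ × ℝ) ∞ (B.block ν k) := by
  refine contMDiff_finsum (fun j ↦ ?_) (B.locallyFinite.subset fun j x hx ↦ ?_)
  · by_cases hc : B.colour j = k
    · simp only [if_pos hc]
      refine contMDiff_of_tsupport fun x hx ↦ ?_
      have hx' := B.tsupport_subset j (closure_mono (Function.support_smul_subset_left _ _) hx)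
      exact (B.contMDiff_bump j).contMDiffAt.smul
        ((contMDiffAt_of_mem_maximalAtlas (IsManifold.chart_mem_maximalAtlas _) hx').prodMk_space
          contMDiffAt_const)
    · simp only [if_neg hc]
      exact contMDiff_const
  · intro h0
    exact hx (by simp [h0])

/-- The labels tell bumps of the same colour apart, the middle coordinate detects where a bump
equals `1`, and the chart separates points there. -/
theorem injective_block (B : ColouredBumpFamily E M J N) {ν : J → ℕ} (hν : Function.Injective ν) :
    Function.Injective fun x k ↦ B.block ν k x := by
  intro x y hxy
  obtain ⟨j, hj⟩ := B.exists_eq_one x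
  have h1 := B.block_eq_of_eq_one ν hj
  have h2 : B.block ν (B.colour j) x = B.block ν (B.colour j) y := congrFun hxy _
  rw [h1] at h2
  obtain ⟨i, hi, hiy⟩ := B.exists_of_block_ne_zero (ν := ν) (k := B.colour j) (x := y) (by
    rw [← h2]
    intro h0
    exact one_ne_zero (congrArg (fun p : E × ℝ × ℝ ↦ p.2.1) h0))
  rw [← hi, B.block_eq ν hiy] at h2
  simp only [Prod.smul_mk, smul_eq_mul, mul_one, Prod.mk.injEq] at h2
  obtain ⟨hchart, hone, hlabel⟩ := h2
  rw [← hone, one_mul] at hlabel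
  have hij : j = i := hν (by exact_mod_cast hlabel)
  subst hij
  rw [← hone, one_smul] at hchart
  exact (chartAt E (B.center j)).injOn (B.mem_source (by rw [hj]; exact one_ne_zero))
    (B.mem_source hiy) hchart

/-- Only finitely many bumps have a label below a given bound, and their supports are compact. -/
theorem isProperMap_block [IsManifold 𝓘(ℝ, E) ∞ M] [FiniteDimensional ℝ E]
    (B : ColouredBumpFamily E M J N) {ν : J → ℕ} (hν : Function.Injective ν) :
    IsProperMap fun x k ↦ B.block ν k x := by
  have hc : Continuous fun x k ↦ B.block ν k x :=
    continuous_pi fun k ↦ (B.contMDiff_block ν k).continuous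
  refine isProperMap_iff_isCompact_preimage.2 ⟨hc, fun K hK ↦ ?_⟩
  obtain ⟨R, hR⟩ := hK.isBounded.exists_norm_le
  have hfin : {j | ν j ≤ ⌊R⌋₊}.Finite := (finite_le_nat ⌊R⌋₊).preimage hν.injOn
  refine (hfin.isCompact_biUnion fun j _ ↦ B.hasCompactSupport j).of_isClosed_subset
    (hK.isClosed.preimage hc) fun x hx ↦ ?_
  obtain ⟨j, hj⟩ := B.exists_eq_one x
  refine mem_iUnion₂.2 ⟨j, Nat.le_floor ?_, subset_tsupport _ (by simp [hj])⟩
  calc (ν j : ℝ) = ‖(B.block ν (B.colour j) x).2.2‖ := by simp [B.block_eq_of_eq_one ν hj]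
    _ ≤ ‖B.block ν (B.colour j) x‖ := (norm_snd_le _).trans (norm_snd_le _)
    _ ≤ ‖fun k ↦ B.block ν k x‖ := norm_le_pi_norm (fun k ↦ B.block ν k x) _
    _ ≤ R := hR _ hx

end ColouredBumpFamily

/-- Every manifold admits a proper injective immersion into a Euclidean space. The charts of a
coloured bump family, read off from the target by linear projections, show that the map is an
immersion; all these projections have kernels of the same dimension, hence a common complement. -/
theorem exists_isImmersionOfComplement_isProperMap_injective (m : ℕ) (M : Type*)
    [TopologicalSpace M] [T2Space M] [SecondCountableTopology M] [ChartedSpace (EuclideanSpace ℝ (Fin m)) M]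
    [IsManifold (𝓡 m) ∞ M] :
    ∃ (n : ℕ) (f : M → EuclideanSpace ℝ (Fin n)),
      Manifold.IsImmersionOfComplement (EuclideanSpace ℝ (Fin (n - m))) (𝓡 m) (𝓡 n) ∞ f ∧
        IsProperMap f ∧ Function.Injective f := by
  obtain ⟨J, hJ, ⟨B⟩⟩ := exists_colouredBumpFamily (E := EuclideanSpace ℝ (Fin m)) (M := M)
  obtain ⟨ν, hν⟩ := exists_injective_nat J
  set E := EuclideanSpace ℝ (Fin m)
  set P := Fin (Module.finrank ℝ E + 2) → E × ℝ × ℝ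
  set n := Module.finrank ℝ P
  let e : P ≃L[ℝ] EuclideanSpace ℝ (Fin n) :=
    ContinuousLinearEquiv.ofFinrankEq finrank_euclideanSpace_fin.symm
  have hs : ContMDiff (𝓡 m) (𝓡 n) ∞ fun x ↦ e fun k ↦ B.block ν k x :=
    e.contDiff.contMDiff.comp (contMDiff_pi_space.2 fun k ↦ B.contMDiff_block ν k)
  refine ⟨n, fun x ↦ e fun k ↦ B.block ν k x, fun x ↦ ?_,
    e.toHomeomorph.isProperMap.comp (B.isProperMap_block hν),
    e.injective.comp (B.injective_block hν)⟩
  obtain ⟨j, hj⟩ := B.exists_eventuallyEq_one x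
  obtain ⟨V, hV, hVo, hxV⟩ := mem_nhds_iff.1 hj
  let L : EuclideanSpace ℝ (Fin n) →L[ℝ] E :=
    (ContinuousLinearMap.fst ℝ E (ℝ × ℝ)).comp
      ((ContinuousLinearMap.proj (R := ℝ) (φ := fun _ ↦ E × ℝ × ℝ) (B.colour j)).comp
        (e.symm : EuclideanSpace ℝ (Fin n) →L[ℝ] P))
  let s : E →L[ℝ] EuclideanSpace ℝ (Fin n) :=
    (e : P →L[ℝ] EuclideanSpace ℝ (Fin n)).comp
      ((ContinuousLinearMap.single ℝ (fun _ ↦ E × ℝ × ℝ) (B.colour j)).comp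
        (ContinuousLinearMap.inl ℝ E (ℝ × ℝ)))
  have hLs : Function.RightInverse s L := fun u ↦ by simp [L, s]
  have hrank : Module.finrank ℝ (EuclideanSpace ℝ (Fin (n - m))) = Module.finrank ℝ L.ker := by
    have h1 := (ContinuousLinearEquiv.equivOfRightInverse L s hLs).toLinearEquiv.finrank_eq
    rw [Module.finrank_prod, finrank_euclideanSpace_fin, finrank_euclideanSpace_fin] at h1
    rw [finrank_euclideanSpace_fin]
    omega
  have hxs : x ∈ (chartAt E (B.center j)).source :=
    B.mem_source (by rw [hj.eq_of_nhds]; exact one_ne_zero)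
  refine Manifold.isImmersionAtOfComplement_of_linear_comp_eq_chart hs
    ((chartAt E (B.center j)).restr V) ?_
    (restr_mem_maximalAtlas _ (IsManifold.chart_mem_maximalAtlas _) hVo) L s hLs ?_
    (ContinuousLinearEquiv.ofFinrankEq hrank)
  · rw [OpenPartialHomeomorph.restr_source' _ _ hVo]
    exact ⟨hxs, hxV⟩
  · intro y hy
    rw [OpenPartialHomeomorph.restr_source' _ _ hVo] at hy
    simp [L, B.block_eq_of_eq_one ν (hV hy.2)]

theorem mainTheorem5 {m : ℕ} {M : Type*} [TopologicalSpace M] [T2Space M]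
    [SecondCountableTopology M] [ChartedSpace (EuclideanSpace ℝ (Fin m)) M]
    [IsManifold (𝓡 m) ∞ M] {ι : Type*} [Nonempty ι] (U : ι → Set M)
    (hUopen : ∀ i, IsOpen (U i)) (hUcover : ⋃ i, U i = Set.univ) :
    (∃ (n : ℕ) (f : M → EuclideanSpace ℝ (Fin n)),
      Manifold.IsSmoothEmbedding (𝓡 m) (𝓡 n) ∞ f ∧ IsProperMap f ∧
        ∀ c : EuclideanSpace ℝ (Fin n),
          IsOpen (f ⁻¹' Metric.ball c 1) ∧ ∃ i, f ⁻¹' Metric.ball c 1 ⊆ U i) ∧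
    (Nonempty (Diffeomorph (𝓡 m) (𝓡 m) M (EuclideanSpace ℝ (Fin m)) ∞) →
      ∃ f : Diffeomorph (𝓡 m) (𝓡 m) M (EuclideanSpace ℝ (Fin m)) ∞,
        ∀ c : EuclideanSpace ℝ (Fin m),
          IsOpen (f ⁻¹' Metric.ball c 1) ∧ ∃ i, f ⁻¹' Metric.ball c 1 ⊆ U i) := by
  refine ⟨?_, fun ⟨φ⟩ ↦ ?_⟩
  · obtain ⟨n, f, himm, hprop, hinj⟩ := exists_isImmersionOfComplement_isProperMap_injective m M
    have hemb : IsClosedEmbedding f :=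
      .of_continuous_injective_isClosedMap hprop.continuous hinj hprop.isClosedMap
    choose W hWo hWU using fun i ↦ hemb.isInducing.isOpen_iff.1 (hUopen i)
    -- adding the complement of the closed set `range f` turns the `W i` into a cover
    obtain ⟨G, hG⟩ := exists_diffeomorph_preimage_ball_subset (fun i ↦ W i ∪ (range f)ᶜ)
      (fun i ↦ (hWo i).union hemb.isClosed_range.isOpen_compl) (by
        refine eq_univ_of_forall fun y ↦ mem_iUnion.2 ?_
        by_cases hy : y ∈ range f
        · obtain ⟨x, rfl⟩ := hy
          obtain ⟨i, hi⟩ := mem_iUnion.1 (hUcover.symm ▸ mem_univ x : x ∈ ⋃ i, U i)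
          rw [← hWU i] at hi
          exact ⟨i, Or.inl hi⟩
        · exact ⟨Classical.arbitrary ι, Or.inr hy⟩)
    have hprop' : IsProperMap (G ∘ f) := G.toHomeomorph.isProperMap.comp hprop
    refine ⟨n, G ∘ f, ⟨⟨_, _, _, fun x ↦ (himm x).diffeomorph_comp G⟩,
      G.toHomeomorph.isEmbedding.comp hemb.isEmbedding⟩, hprop', fun c ↦
      ⟨Metric.isOpen_ball.preimage hprop'.continuous, ?_⟩⟩
    obtain ⟨i, hi⟩ := hG c
    refine ⟨i, fun x hx ↦ ?_⟩
    rw [← hWU i]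
    exact (hi hx).resolve_right fun h ↦ h (mem_range_self x)
  · obtain ⟨G, hG⟩ := exists_diffeomorph_preimage_ball_subset (fun i ↦ φ.symm ⁻¹' U i)
      (fun i ↦ (hUopen i).preimage φ.symm.continuous) (by
        rw [← preimage_iUnion, hUcover, preimage_univ])
    refine ⟨φ.trans G, fun c ↦ ⟨Metric.isOpen_ball.preimage (φ.trans G).continuous, ?_⟩⟩
    obtain ⟨i, hi⟩ := hG c
    refine ⟨i, fun x hx ↦ ?_⟩
    simpa using hi (show φ x ∈ G ⁻¹' Metric.ball c 1 from hx)
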